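/- Let $(m_n)_{n\ge1}$ be a sequence of positive numbers such that, for some $0<c\le1$ and $\tfrac1{13}<\mathfrak d<\tfrac12$, one has $c\,n^{\mathfrak d}\le m_n\le c^{-1}n^{\mathfrak d}$ for all integers $n\ge1$. For $b\in\mathbb Z$ let $S^b=(S^b(u))_{u\ge0}$ be the lazy random walk on $\mathbb Z$ started at $S^b(0)=b$, that is, its increments $S^b(u+1)-S^b(u)$, $u\ge 0$, are independent and uniformly distributed on $\{-1,0,1\}$. For $a\in\mathbb Z$ and an integer $u\ge0$ let $$\Lambda^a_u(S^b):=\sum_{j=0}^{u}\mathbf 1_{\{S^b(j)=a\}}$$ be its vertex-occupation measures. Fix $t>0$ and, for $n\ge 1$ and $x\ge0$, put $\theta=\theta(n,t):=\lfloor m_n^2t\rfloor$ and $x^n:=\lfloor m_nx\rfloor$. Then for every $C>0$ and every real $1\le q<3$, $$\sup_{n\in\mathbb N,\;x\ge0}\ \mathbf E\left[\exp\left(\frac{C}{m_n}\sum_{a\in\mathbb Z}\frac{\Lambda^a_\theta(S^{x^n})^q}{m_n^q}\right)\right]<\infty,$$ where $\mathbb N=\{1,2,\dots\}$. -/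

import Mathlib

open MeasureTheory ProbabilityTheory
open scoped ENNReal NNReal

/-- The standing growth assumption on the sequence of positive numbers `(m_n)_{n ≥ 1}`:
for some `0 < c ≤ 1` and `1/13 < d < 1/2` one has `c n^d ≤ m_n ≤ c⁻¹ n^d` for all `n ≥ 1`. -/
def ScalingSequence (m : ℕ → ℝ) : Prop :=
  ∃ c d : ℝ, 0 < c ∧ c ≤ 1 ∧ 1 / 13 < d ∧ d < 1 / 2 ∧
    ∀ n : ℕ, 1 ≤ n → c * (n : ℝ) ^ d ≤ m n ∧ m n ≤ c⁻¹ * (n : ℝ) ^ d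

/-- Under `μ`, the process `S` is a lazy random walk on `ℤ` started at `a`: its increments
`S (u + 1) - S u` are i.i.d. uniform on `{-1, 0, 1}`, and `S 0 = a` almost surely. -/
structure IsLazyWalkFrom {Ω : Type*} [MeasurableSpace Ω] (μ : Measure Ω) (a : ℤ)
    (S : ℕ → Ω → ℤ) : Prop where
  measurable : ∀ u, Measurable (S u)
  start : ∀ᵐ ω ∂μ, S 0 ω = a
  indep : iIndepFun (fun (u : ℕ) (ω : Ω) => S (u + 1) ω - S u ω) μ
  uniform : ∀ u, μ.map (fun ω => S (u + 1) ω - S u ω) = uniformOn ({-1, 0, 1} : Set ℤ)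

/-- The vertex-occupation measure `Λ^a_u(s) = ∑_{j=0}^{u} 1_{s(j) = a}` of a path `s`. -/
def vertexOccupation (s : ℕ → ℤ) (u : ℕ) (a : ℤ) : ℕ :=
  ∑ j ∈ Finset.range (u + 1), if s j = a then 1 else 0

/-! Telescoping `Λ^q` over the visits to a site and summing over sites bounds `∑_a Λ_a^q` by `q ∑_j
Z_j^(q-1)`, where `Z_j` counts the returns to `S j` after time `j`. The scaling makes the exponent
at most an average over `j` of `D (Z_j / m_n)^(q-1)`, so by Jensen one `j` suffices. `Z_j` depends
on increments only, hence the uniformity in `x`. The variable `Z_j / m_n` has a Gaussian moment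
bound uniform in `n` and `j` (`lintegral_exp_zeroCount_le`). Since `q - 1 < 2`, the exponential
moment of its power is finite (`exists_lintegral_exp_rpow_le`). -/

lemma lintegral_uniformOn_neg_one_zero_one (f : ℤ → ℝ≥0∞) :
    ∫⁻ z, f z ∂(uniformOn ({-1, 0, 1} : Set ℤ)) = 3⁻¹ * (f (-1) + f 0 + f 1) := by
  have hs : ({-1, 0, 1} : Set ℤ) = (({-1, 0, 1} : Finset ℤ) : Set ℤ) := by simp
  rw [uniformOn, ProbabilityTheory.cond, lintegral_smul_measure, hs, lintegral_finset,
    Measure.count_apply_finset, smul_eq_mul]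
  norm_num [add_assoc]

/-! ### Exponential moments of the zero count. -/

lemma exp_neg_le_one_sub_half {α : ℝ} (h0 : 0 ≤ α) (h1 : α ≤ 1) :
    Real.exp (-α) ≤ 1 - α / 2 := by
  rw [Real.exp_neg]
  have h := Real.add_one_le_exp α
  rw [inv_le_comm₀ (Real.exp_pos α) (by linarith)]
  refine le_trans ?_ h
  rw [inv_le_comm₀ (by linarith) (by linarith), inv_le_iff_one_le_mul₀ (by linarith)]
  nlinarith

/-- Away from `0`, averaging multiplies `exp (-α|x|)` by `(1 + 2 cosh α) / 3`, at most `exp (α²/2)`.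
At `0` the kink of `|x|` gives a loss of order `α`, which pays for the reward `exp (α/6)`. -/
lemma exp_mul_average_le {α : ℝ} (h0 : 0 ≤ α) (h1 : α ≤ 1) (x : ℤ) :
    Real.exp (α / 6 * if x = 0 then 1 else 0) *
      (((1 + Real.exp (-α * |((x + -1 : ℤ) : ℝ)|)) + (1 + Real.exp (-α * |((x + 0 : ℤ) : ℝ)|)) +
        (1 + Real.exp (-α * |((x + 1 : ℤ) : ℝ)|))) / 3) ≤
      Real.exp (α ^ 2 / 2) * (1 + Real.exp (-α * |(x : ℝ)|)) := by
  have hc1 : 1 ≤ Real.cosh α := Real.one_le_cosh α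
  have hc2 : Real.cosh α ≤ Real.exp (α ^ 2 / 2) := Real.cosh_le_exp_half_sq α
  by_cases hx : x = 0
  · subst hx
    have h2 := exp_neg_le_one_sub_half h0 h1
    have h3 := Real.add_one_le_exp (-(α / 6))
    have h4 : Real.exp (α / 6) * Real.exp (-(α / 6)) = 1 := by
      rw [← Real.exp_add]; simp
    norm_num
    -- The constant `6`: the average is at most `(4 + 2(1 - α/2)) / 3 = 2(1 - α/6)`.
    have : Real.exp (α / 6) * ((1 + Real.exp (-α) + (1 + 1) + (1 + Real.exp (-α))) / 3) ≤
        Real.exp (α / 6) * (2 * Real.exp (-(α / 6))) := by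
      gcongr
      linarith
    nlinarith
  · have key : Real.exp (-α * |((x + -1 : ℤ) : ℝ)|) + Real.exp (-α * |((x + 1 : ℤ) : ℝ)|) =
        2 * Real.cosh α * Real.exp (-α * |(x : ℝ)|) := by
      rw [Real.cosh_eq]
      rcases lt_or_gt_of_ne hx with hneg | hpos
      · have e1 : (x : ℝ) ≤ -1 := by exact_mod_cast (by omega : x ≤ -1)
        push_cast
        rw [abs_of_nonpos (by linarith), abs_of_nonpos (by linarith), abs_of_nonpos (by linarith)]
        rw [show -α * -((x : ℝ) + -1) = -α + -α * -(x : ℝ) by ring,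
          show -α * -((x : ℝ) + 1) = α + -α * -(x : ℝ) by ring, Real.exp_add, Real.exp_add]
        ring
      · have e1 : (1 : ℝ) ≤ x := by exact_mod_cast hpos
        push_cast
        rw [abs_of_nonneg (by linarith), abs_of_nonneg (by linarith), abs_of_nonneg (by linarith)]
        rw [show -α * ((x : ℝ) + -1) = α + -α * (x : ℝ) by ring,
          show -α * ((x : ℝ) + 1) = -α + -α * (x : ℝ) by ring, Real.exp_add, Real.exp_add]
        ring
    have hp := Real.exp_pos (-α * |(x : ℝ)|)
    simp only [hx, if_false, mul_zero, Real.exp_zero, one_mul, add_zero]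
    nlinarith [mul_le_mul_of_nonneg_right hc1 hp.le, mul_le_mul_of_nonneg_right hc2 hp.le]

/-- The number of times `i < N` at which the partial sum `∑_{k < i} ξ k` vanishes. -/
def zeroCount (ξ : ℕ → ℤ) (N : ℕ) : ℕ :=
  ∑ i ∈ Finset.range N, if ∑ k ∈ Finset.range i, ξ k = 0 then 1 else 0

lemma zeroCount_succ (ξ : ℕ → ℤ) (N : ℕ) : zeroCount ξ (N + 1) =
    zeroCount ξ N + if ∑ k ∈ Finset.range N, ξ k = 0 then 1 else 0 := by
  exact Finset.sum_range_succ ..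

lemma zeroCount_le (ξ : ℕ → ℤ) (N : ℕ) : zeroCount ξ N ≤ N := by
  refine (Finset.sum_le_card_nsmul _ _ 1 fun i _ => ?_).trans (by simp)
  split_ifs <;> simp

lemma zeroCount_congr {ξ η : ℕ → ℤ} {N : ℕ} (h : ∀ k < N, ξ k = η k) :
    zeroCount ξ N = zeroCount η N := by
  refine Finset.sum_congr rfl fun i hi => ?_
  rw [Finset.sum_congr rfl fun k hk => h k ?_]
  rw [Finset.mem_range] at *
  omega

/-- The exponential of the zero count, weighted by a function of the endpoint. -/
noncomputable def weightedExp (α : ℝ) (ξ : ℕ → ℤ) (N : ℕ) : ℝ :=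
  Real.exp (α / 6 * zeroCount ξ N) *
    (1 + Real.exp (-α * |((∑ k ∈ Finset.range N, ξ k : ℤ) : ℝ)|))

section

variable {Ω : Type*} [MeasurableSpace Ω] {μ : Measure Ω} [IsProbabilityMeasure μ]

/-- The zero count at `N + 1` only involves the first `N` increments, so the independent `ξ N` can
be integrated out first. -/
lemma lintegral_weightedExp_succ_le {ξ : ℕ → Ω → ℤ} (hmeas : ∀ k, Measurable (ξ k))
    (hind : iIndepFun ξ μ) (hunif : ∀ k, μ.map (ξ k) = uniformOn ({-1, 0, 1} : Set ℤ))
    {α : ℝ} (h0 : 0 ≤ α) (h1 : α ≤ 1) (N : ℕ) :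
    ∫⁻ ω, ENNReal.ofReal (weightedExp α (fun k => ξ k ω) (N + 1)) ∂μ ≤
      ENNReal.ofReal (Real.exp (α ^ 2 / 2)) *
        ∫⁻ ω, ENNReal.ofReal (weightedExp α (fun k => ξ k ω) N) ∂μ := by
  classical
  let P : Ω → (Finset.range N → ℤ) := fun ω i => ξ i ω
  have hP : Measurable P := measurable_pi_lambda _ fun i => hmeas i
  have hPξ : IndepFun P (ξ N) μ := by
    have := hind.indepFun_finset (Finset.range N) {N} (by simp) hmeas
    exact this.comp (φ := id) (ψ := fun f : (({N} : Finset ℕ) → ℤ) => f ⟨N, by simp⟩)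
      measurable_id (measurable_pi_apply _)
  let ext : (Finset.range N → ℤ) → ℕ → ℤ := fun p k => if h : k ∈ Finset.range N then p ⟨k, h⟩ else 0
  have hext : ∀ ω, ∀ k < N, ext (P ω) k = ξ k ω := by
    intro ω k hk
    simp [ext, P, hk]
  let W : (Finset.range N → ℤ) → ℤ := fun p => ∑ k ∈ Finset.range N, ext p k
  let A : (Finset.range N → ℤ) → ℝ := fun p =>
    Real.exp (α / 6 * zeroCount (ext p) N)
  let φ : (Finset.range N → ℤ) × ℤ → ℝ≥0∞ := fun z =>
    ENNReal.ofReal (A z.1 * Real.exp (α / 6 * if W z.1 = 0 then 1 else 0) *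
      (1 + Real.exp (-α * |((W z.1 + z.2 : ℤ) : ℝ)|)))
  have hW : ∀ ω, W (P ω) = ∑ k ∈ Finset.range N, ξ k ω := fun ω =>
    Finset.sum_congr rfl fun k hk => hext ω k (Finset.mem_range.1 hk)
  have hA : ∀ ω, A (P ω) = Real.exp (α / 6 * zeroCount (fun k => ξ k ω) N) := fun ω => by
    simp only [A, zeroCount_congr (hext ω)]
  have e1 : ∀ ω, ENNReal.ofReal (weightedExp α (fun k => ξ k ω) (N + 1)) = φ (P ω, ξ N ω) := by
    intro ω
    simp only [φ, weightedExp, hA, hW, zeroCount_succ, Finset.sum_range_succ, ← Real.exp_add]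
    push_cast
    rw [← mul_add (α / 6)]
  have hmφ : Measurable φ := measurable_of_countable _
  simp_rw [e1]
  rw [← lintegral_map (f := φ) (g := fun ω => (P ω, ξ N ω)) hmφ (hP.prodMk (hmeas N)),
    (indepFun_iff_map_prod_eq_prod_map_map hP.aemeasurable (hmeas N).aemeasurable).1 hPξ,
    lintegral_prod _ hmφ.aemeasurable, lintegral_map (measurable_of_countable _) hP, hunif,
    ← lintegral_const_mul' _ _ ENNReal.ofReal_ne_top]
  refine lintegral_mono fun ω => ?_
  simp only [lintegral_uniformOn_neg_one_zero_one]
  have h3 : (3 : ℝ≥0∞)⁻¹ = ENNReal.ofReal (1 / 3) := by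
    rw [one_div, ENNReal.ofReal_inv_of_pos (by norm_num)]; norm_num
  have key := exp_mul_average_le h0 h1 (W (P ω))
  have hApos : 0 ≤ A (P ω) := (Real.exp_pos _).le
  simp only [φ]
  rw [h3, ← ENNReal.ofReal_add (by positivity) (by positivity),
    ← ENNReal.ofReal_add (by positivity) (by positivity), ← ENNReal.ofReal_mul (by norm_num),
    ← ENNReal.ofReal_mul (by positivity)]
  refine ENNReal.ofReal_le_ofReal ?_
  rw [weightedExp, ← hA, ← hW]
  calc _ = A (P ω) * _ := by ring
    _ ≤ A (P ω) * _ := mul_le_mul_of_nonneg_left key hApos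
    _ = _ := by ring

lemma lintegral_weightedExp_le {ξ : ℕ → Ω → ℤ} (hmeas : ∀ k, Measurable (ξ k))
    (hind : iIndepFun ξ μ) (hunif : ∀ k, μ.map (ξ k) = uniformOn ({-1, 0, 1} : Set ℤ))
    {α : ℝ} (h0 : 0 ≤ α) (h1 : α ≤ 1) (N : ℕ) :
    ∫⁻ ω, ENNReal.ofReal (weightedExp α (fun k => ξ k ω) N) ∂μ ≤
      ENNReal.ofReal (2 * Real.exp (N * (α ^ 2 / 2))) := by
  induction N with
  | zero => simp [weightedExp, zeroCount]; norm_num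
  | succ N ih =>
    refine (lintegral_weightedExp_succ_le hmeas hind hunif h0 h1 N).trans ?_
    refine (mul_le_mul_right ih _).trans_eq ?_
    rw [← ENNReal.ofReal_mul (by positivity)]
    push_cast
    rw [add_mul, Real.exp_add, one_mul]
    ring_nf

lemma lintegral_exp_zeroCount_le {ξ : ℕ → Ω → ℤ} (hmeas : ∀ k, Measurable (ξ k))
    (hind : iIndepFun ξ μ) (hunif : ∀ k, μ.map (ξ k) = uniformOn ({-1, 0, 1} : Set ℤ))
    {α : ℝ} (h0 : 0 ≤ α) (N : ℕ) :
    ∫⁻ ω, ENNReal.ofReal (Real.exp (α / 6 * zeroCount (fun k => ξ k ω) N)) ∂μ ≤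
      ENNReal.ofReal (2 * Real.exp (N * α ^ 2)) := by
  -- For `α ≥ 1` the bound is trivial, as the count is at most `N` and `α/6 ≤ α²`.
  rcases le_total α 1 with h1 | h1
  · calc _ ≤ ∫⁻ ω, ENNReal.ofReal (weightedExp α (fun k => ξ k ω) N) ∂μ := by
          refine lintegral_mono fun ω => ENNReal.ofReal_le_ofReal ?_
          exact le_mul_of_one_le_right (Real.exp_pos _).le
            (le_add_of_nonneg_right (Real.exp_pos _).le)
      _ ≤ _ := lintegral_weightedExp_le hmeas hind hunif h0 h1 N
      _ ≤ _ := by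
          gcongr
          nlinarith [sq_nonneg α]
  · calc _ ≤ ∫⁻ _, ENNReal.ofReal (2 * Real.exp (N * α ^ 2)) ∂μ := by
          refine lintegral_mono fun ω => ENNReal.ofReal_le_ofReal ?_
          have h2 : (zeroCount (fun k => ξ k ω) N : ℝ) ≤ N := by exact_mod_cast zeroCount_le _ N
          have h3 : α / 6 * zeroCount (fun k => ξ k ω) N ≤ N * α ^ 2 := by
            have : α / 6 ≤ α ^ 2 := by nlinarith
            calc _ ≤ α ^ 2 * N := by gcongr
              _ = _ := by ring
          have := Real.exp_le_exp.2 h3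
          have := Real.exp_pos (N * α ^ 2)
          linarith
      _ = _ := by simp

end

/-! ### Pathwise bound on the powers of the occupation measures. -/

lemma add_one_rpow_sub_rpow_le {q : ℝ} (hq : 1 ≤ q) {x : ℝ} (hx : 0 ≤ x) :
    (x + 1) ^ q - x ^ q ≤ q * (x + 1) ^ (q - 1) := by
  have hx1 : 0 < x + 1 := by linarith
  -- Bernoulli's inequality for `x / (x + 1) = 1 - 1 / (x + 1)`.
  have hb := one_add_mul_self_le_rpow_one_add (s := -(x + 1)⁻¹)
    (neg_le_neg (inv_le_one_of_one_le₀ (by linarith))) hq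
  have e : 1 + -(x + 1)⁻¹ = x / (x + 1) := by field_simp; ring
  rw [e, Real.div_rpow hx hx1.le, le_div_iff₀ (Real.rpow_pos_of_pos hx1 q)] at hb
  rw [Real.rpow_sub_one hx1.ne']
  have : (1 + q * -(x + 1)⁻¹) * (x + 1) ^ q = (x + 1) ^ q - q * ((x + 1) ^ q / (x + 1)) := by
    field_simp; ring
  linarith

/-- The number of visits of `s` to `a` at times in `[j, n)`. -/
def visitsFrom (s : ℕ → ℤ) (n : ℕ) (a : ℤ) (j : ℕ) : ℕ :=
  ∑ i ∈ Finset.Ico j n, if s i = a then 1 else 0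

lemma visitsFrom_eq_succ (s : ℕ → ℤ) {n : ℕ} (a : ℤ) {j : ℕ} (hj : j < n) :
    visitsFrom s n a j = visitsFrom s n a (j + 1) + if s j = a then 1 else 0 := by
  rw [visitsFrom, Finset.sum_eq_sum_Ico_succ_bot hj, add_comm]; rfl

lemma visitsFrom_zero (s : ℕ → ℤ) (u : ℕ) (a : ℤ) :
    visitsFrom s (u + 1) a 0 = vertexOccupation s u a := by
  rw [visitsFrom, vertexOccupation, Finset.range_eq_Ico]

/-- The window is lengthened to `n` steps for every `j`, so that one moment bound serves all `j`. -/
lemma visitsFrom_le_zeroCount (s : ℕ → ℤ) (n j : ℕ) :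
    visitsFrom s n (s j) j ≤ zeroCount (fun k => s (j + k + 1) - s (j + k)) n := by
  rw [visitsFrom, Finset.sum_Ico_eq_sum_range, zeroCount]
  have h : ∀ i, ∑ k ∈ Finset.range i, (s (j + k + 1) - s (j + k)) = s (j + i) - s j :=
    fun i => Finset.sum_range_sub (fun k => s (j + k)) i
  simp only [h, sub_eq_zero]
  exact Finset.sum_le_sum_of_subset (Finset.range_mono (Nat.sub_le n j))

/-- The `q`-th power of the remaining visits telescopes in `j`, changing only when `s j = a`. -/
lemma vertexOccupation_rpow_le {q : ℝ} (hq : 1 ≤ q) (s : ℕ → ℤ) (u : ℕ) (a : ℤ) :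
    (vertexOccupation s u a : ℝ) ^ q ≤ ∑ j ∈ Finset.range (u + 1),
      if s j = a then q * (visitsFrom s (u + 1) a j : ℝ) ^ (q - 1) else 0 := by
  have hz : (visitsFrom s (u + 1) a (u + 1) : ℝ) ^ q = 0 := by
    simp [visitsFrom, Real.zero_rpow (by linarith : q ≠ 0)]
  have h := Finset.sum_range_sub' (fun j => (visitsFrom s (u + 1) a j : ℝ) ^ q) (u + 1)
  rw [hz, sub_zero, visitsFrom_zero] at h
  rw [← h]
  refine Finset.sum_le_sum fun j hj => ?_
  rw [visitsFrom_eq_succ s a (Finset.mem_range.1 hj)]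
  split_ifs with hja
  · push_cast
    exact add_one_rpow_sub_rpow_le hq (Nat.cast_nonneg _)
  · simp

lemma tsum_vertexOccupation_rpow_le {q : ℝ} (hq : 1 ≤ q) (s : ℕ → ℤ) (u : ℕ) {r : ℝ}
    (hr : 0 ≤ r) :
    ∑' a : ℤ, (vertexOccupation s u a : ℝ) ^ q / r ≤ (∑ j ∈ Finset.range (u + 1),
      q * (zeroCount (fun k => s (j + k + 1) - s (j + k)) (u + 1) : ℝ) ^ (q - 1)) / r := by
  classical
  rw [tsum_eq_sum (s := (Finset.range (u + 1)).image s), ← Finset.sum_div]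
  · refine div_le_div_of_nonneg_right ?_ hr
    refine (Finset.sum_le_sum fun a _ => vertexOccupation_rpow_le hq s u a).trans ?_
    rw [Finset.sum_comm]
    refine Finset.sum_le_sum fun j hj => ?_
    rw [Finset.sum_ite_eq, if_pos (Finset.mem_image_of_mem s hj)]
    have := visitsFrom_le_zeroCount s (u + 1) j
    have hq' : 0 ≤ q - 1 := by linarith
    gcongr
  · intro a ha
    have : vertexOccupation s u a = 0 := by
      refine Finset.sum_eq_zero fun j hj => if_neg ?_
      rintro rfl
      exact ha (Finset.mem_image_of_mem s hj)
    simp [this, Real.zero_rpow (by linarith : q ≠ 0)]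

/-! ### From Gaussian moment bounds to exponential moments of subquadratic powers. -/

lemma exists_mul_rpow_le_mul_sq_add {D p ε : ℝ} (hD : 0 < D) (hp0 : 0 ≤ p) (hp2 : p < 2)
    (hε : 0 < ε) : ∃ E : ℝ, ∀ y : ℝ, 0 ≤ y → D * y ^ p ≤ ε * y ^ 2 + E := by
  -- The threshold where `D y^p = ε y²`.
  have hR : 0 < (D / ε) ^ (1 / (2 - p)) := Real.rpow_pos_of_pos (by positivity) _
  have hRp : ((D / ε) ^ (1 / (2 - p))) ^ (2 - p) = D / ε := by
    rw [← Real.rpow_mul (by positivity), one_div_mul_cancel (by linarith), Real.rpow_one]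
  set R := (D / ε) ^ (1 / (2 - p))
  refine ⟨D * R ^ p, fun y hy => ?_⟩
  rcases le_total y R with h | h
  · have : D * y ^ p ≤ D * R ^ p := by gcongr
    have : 0 ≤ ε * y ^ 2 := by positivity
    linarith
  · have hy' : 0 < y := hR.trans_le h
    have h1 : D / ε ≤ y ^ (2 - p) := by
      rw [← hRp]
      exact Real.rpow_le_rpow hR.le h (by linarith)
    have h2 : y ^ 2 = y ^ (2 - p) * y ^ p := by
      rw [← Real.rpow_add hy', ← Real.rpow_natCast]; norm_num
    rw [div_le_iff₀ hε] at h1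
    have h3 : 0 ≤ y ^ p := by positivity
    have : 0 ≤ D * R ^ p := by positivity
    rw [h2]
    nlinarith [mul_le_mul_of_nonneg_right h1 h3]

/-- The term `k = ⌊y⌋` suffices. The slope `k / (2B)` is the Chernoff choice, minimising `B l² - l
k`. -/
lemma ofReal_exp_sq_le_tsum {ε B y : ℝ} (hε : 0 ≤ ε) (hB : 0 ≤ B) (hy : 0 ≤ y) :
    ENNReal.ofReal (Real.exp (ε * y ^ 2)) ≤ ∑' k : ℕ,
      ENNReal.ofReal (Real.exp (ε * (k + 1) ^ 2 - k / (2 * B) * k)) *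
        ENNReal.ofReal (Real.exp (k / (2 * B) * y)) := by
  refine le_trans ?_ (ENNReal.le_tsum ⌊y⌋₊)
  rw [← ENNReal.ofReal_mul (Real.exp_pos _).le, ← Real.exp_add]
  refine ENNReal.ofReal_le_ofReal (Real.exp_le_exp.2 ?_)
  have h1 := Nat.floor_le hy
  have h2 := (Nat.lt_floor_add_one y).le
  have h3 : ε * y ^ 2 ≤ ε * ((⌊y⌋₊ : ℝ) + 1) ^ 2 := by gcongr
  have h4 : 0 ≤ (⌊y⌋₊ : ℝ) / (2 * B) * (y - ⌊y⌋₊) :=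
    mul_nonneg (by positivity) (by linarith)
  linarith

/-- The Chernoff gain is `k² / (4B)`, so `ε = 1 / (16B)` leaves quadratic decay, compared here with
a geometric series. -/
lemma tsum_ofReal_gaussian_ne_top {B : ℝ} (hB : 0 < B) : ∑' k : ℕ,
    ENNReal.ofReal (Real.exp (1 / (16 * B) * ((k : ℝ) + 1) ^ 2 - k / (2 * B) * k)) *
      ENNReal.ofReal (2 * Real.exp (B * (k / (2 * B)) ^ 2)) ≠ ∞ := by
  have hs : Summable fun k : ℕ => Real.exp (k * (-(1 / (8 * B)))) :=
    Real.summable_exp_nat_mul_iff.2 (neg_lt_zero.2 (by positivity))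
  refine ne_top_of_le_ne_top ((hs.mul_left (2 * Real.exp (1 / (8 * B)))).tsum_ofReal_ne_top) ?_
  refine ENNReal.tsum_le_tsum fun k => ?_
  rw [← ENNReal.ofReal_mul (Real.exp_pos _).le]
  refine ENNReal.ofReal_le_ofReal ?_
  rw [mul_left_comm, ← Real.exp_add, mul_assoc, ← Real.exp_add]
  refine mul_le_mul_of_nonneg_left (Real.exp_le_exp.2 ?_) two_pos.le
  have hk : (k : ℝ) ≤ (k : ℝ) ^ 2 := by exact_mod_cast Nat.le_self_pow two_ne_zero k
  have e : 1 / (8 * B) + k * (-(1 / (8 * B))) - (1 / (16 * B) * ((k : ℝ) + 1) ^ 2 -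
      k / (2 * B) * k + B * (k / (2 * B)) ^ 2) =
      (1 / (16 * B)) * (2 - 2 * k + 4 * (k : ℝ) ^ 2 - (k + 1) ^ 2) := by
    field_simp; ring
  have : 0 ≤ (1 / (16 * B)) * (2 - 2 * k + 4 * (k : ℝ) ^ 2 - (k + 1) ^ 2) := by
    refine mul_nonneg (by positivity) ?_
    nlinarith [sq_nonneg ((k : ℝ) - 1)]
  linarith

lemma exists_lintegral_exp_rpow_le {D p B : ℝ} (hD : 0 < D) (hp0 : 0 ≤ p) (hp2 : p < 2)
    (hB : 0 < B) : ∃ K : ℝ≥0, ∀ (Ω : Type*) [MeasurableSpace Ω] (μ : Measure Ω) (Y : Ω → ℝ),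
      Measurable Y → (∀ ω, 0 ≤ Y ω) →
      (∀ l : ℝ, 0 ≤ l → ∫⁻ ω, ENNReal.ofReal (Real.exp (l * Y ω)) ∂μ ≤
        ENNReal.ofReal (2 * Real.exp (B * l ^ 2))) →
      ∫⁻ ω, ENNReal.ofReal (Real.exp (D * Y ω ^ p)) ∂μ ≤ K := by
  obtain ⟨E, hE⟩ := exists_mul_rpow_le_mul_sq_add hD hp0 hp2 (by positivity : 0 < 1 / (16 * B))
  have hT := tsum_ofReal_gaussian_ne_top hB
  set T := ∑' k : ℕ,
    ENNReal.ofReal (Real.exp (1 / (16 * B) * ((k : ℝ) + 1) ^ 2 - k / (2 * B) * k)) *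
      ENNReal.ofReal (2 * Real.exp (B * (k / (2 * B)) ^ 2))
  refine ⟨(ENNReal.ofReal (Real.exp E) * T).toNNReal, fun Ω _ μ Y hYm hY hmgf => ?_⟩
  rw [ENNReal.coe_toNNReal (ENNReal.mul_ne_top ENNReal.ofReal_ne_top hT)]
  calc _ ≤ ∫⁻ ω, ENNReal.ofReal (Real.exp E) *
        ∑' k : ℕ, ENNReal.ofReal (Real.exp (1 / (16 * B) * (k + 1) ^ 2 - k / (2 * B) * k)) *
          ENNReal.ofReal (Real.exp (k / (2 * B) * Y ω)) ∂μ := by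
        refine lintegral_mono fun ω => ?_
        refine le_trans ?_ (mul_le_mul_right
          (ofReal_exp_sq_le_tsum (ε := 1 / (16 * B)) (by positivity) hB.le (hY ω)) _)
        rw [← ENNReal.ofReal_mul (Real.exp_pos _).le, ← Real.exp_add]
        refine ENNReal.ofReal_le_ofReal (Real.exp_le_exp.2 ?_)
        linarith [hE (Y ω) (hY ω)]
    _ ≤ _ := by
        rw [lintegral_const_mul' _ _ ENNReal.ofReal_ne_top, lintegral_tsum]
        · refine mul_le_mul_right (ENNReal.tsum_le_tsum fun k => ?_) _
          rw [lintegral_const_mul' _ _ ENNReal.ofReal_ne_top]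
          exact mul_le_mul_right (hmgf _ (by positivity)) _
        · intro k
          fun_prop

/-! ### Scaling, Jensen's inequality and conclusion. -/

lemma ScalingSequence.exists_pos_le {m : ℕ → ℝ} (hm : ScalingSequence m) :
    ∃ c : ℝ, 0 < c ∧ ∀ n : ℕ, 1 ≤ n → c ≤ m n := by
  obtain ⟨c, d, hc, -, hd, -, h⟩ := hm
  refine ⟨c, hc, fun n hn => le_trans ?_ (h n hn).1⟩
  exact le_mul_of_one_le_right hc.le
    (Real.one_le_rpow (by exact_mod_cast hn) (by linarith))

lemma floor_sq_mul_add_one_le {c r t : ℝ} (hc : 0 < c) (hr : c ≤ r) (ht : 0 < t) :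
    ((⌊r ^ 2 * t⌋₊ + 1 : ℕ) : ℝ) ≤ (t + (c ^ 2)⁻¹) * r ^ 2 := by
  have h1 : (⌊r ^ 2 * t⌋₊ : ℝ) ≤ r ^ 2 * t := Nat.floor_le (by positivity)
  have h2 : 1 ≤ (c ^ 2)⁻¹ * r ^ 2 := by
    rw [inv_mul_eq_div, one_le_div (by positivity)]
    gcongr
  push_cast
  linarith

lemma measurable_zeroCount {Ω : Type*} [MeasurableSpace Ω] {ξ : ℕ → Ω → ℤ}
    (hmeas : ∀ k, Measurable (ξ k)) (N : ℕ) :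
    Measurable fun ω => (zeroCount (fun k => ξ k ω) N : ℝ) := by
  refine (measurable_of_countable (fun k : ℕ => (k : ℝ))).comp ?_
  refine Finset.measurable_sum _ fun i _ => ?_
  exact (measurable_of_countable fun z : ℤ => if z = 0 then 1 else 0).comp
    (Finset.measurable_sum _ fun k _ => hmeas k)

lemma exp_tsum_vertexOccupation_le {C q r T : ℝ} (hC : 0 < C) (hq : 1 ≤ q) (hr : 0 < r)
    (s : ℕ → ℤ) (u : ℕ) (hT : ((u + 1 : ℕ) : ℝ) ≤ T * r ^ 2) :
    Real.exp (C / r * ∑' a : ℤ, (vertexOccupation s u a : ℝ) ^ q / r ^ q) ≤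
      ∑ j ∈ Finset.range (u + 1), ((u + 1 : ℕ) : ℝ)⁻¹ * Real.exp (C * q * T *
        ((zeroCount (fun k => s (j + k + 1) - s (j + k)) (u + 1) : ℝ) / r) ^ (q - 1)) := by
  have hn : (0 : ℝ) < ((u + 1 : ℕ) : ℝ) := by positivity
  set n : ℝ := ((u + 1 : ℕ) : ℝ) with hn_def
  set Z : ℕ → ℝ := fun j => (zeroCount (fun k => s (j + k + 1) - s (j + k)) (u + 1) : ℝ)
  have h1 : C / r * ∑' a : ℤ, (vertexOccupation s u a : ℝ) ^ q / r ^ q ≤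
      ∑ j ∈ Finset.range (u + 1), n⁻¹ • (C * q * T * (Z j / r) ^ (q - 1)) := by
    refine (mul_le_mul_of_nonneg_left (tsum_vertexOccupation_rpow_le hq s u
      (Real.rpow_nonneg hr.le q)) (by positivity)).trans ?_
    rw [Finset.sum_div, Finset.mul_sum]
    refine Finset.sum_le_sum fun j _ => ?_
    have hZ : 0 ≤ Z j := Nat.cast_nonneg _
    -- Converts the leftover factor `r⁻²` into the averaging weight `n⁻¹`, at the cost of `T`.
    have hTr : 1 ≤ n⁻¹ * (T * r ^ 2) := by
      rw [inv_mul_eq_div, one_le_div hn]; exact hT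
    have hrq := Real.rpow_pos_of_pos hr q
    have hW : 0 ≤ Z j ^ (q - 1) := Real.rpow_nonneg hZ _
    rw [Real.div_rpow hZ hr.le, Real.rpow_sub_one hr.ne' q, smul_eq_mul]
    calc C / r * (q * Z j ^ (q - 1) / r ^ q) = (C * q * Z j ^ (q - 1) / (r * r ^ q)) * 1 := by
          field_simp
      _ ≤ (C * q * Z j ^ (q - 1) / (r * r ^ q)) * (n⁻¹ * (T * r ^ 2)) := by gcongr
      _ = _ := by field_simp
  refine (Real.exp_le_exp.2 h1).trans ?_
  refine convexOn_exp.map_sum_le (fun _ _ => by positivity) ?_ (fun _ _ => Set.mem_univ _)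
  rw [Finset.sum_const, Finset.card_range, nsmul_eq_mul, mul_inv_cancel₀ hn.ne']

theorem proposition7p2 (m : ℕ → ℝ) (hm : ScalingSequence m) (t : ℝ) (ht : 0 < t)
    (C : ℝ) (hC : 0 < C) (q : ℝ) (hq1 : 1 ≤ q) (hq3 : q < 3) :
    ∃ K : ℝ≥0, ∀ n : ℕ, 1 ≤ n → ∀ x : ℝ, 0 ≤ x →
      ∀ (Ω : Type*) [MeasurableSpace Ω] (μ : Measure Ω) [IsProbabilityMeasure μ]
        (S : ℕ → Ω → ℤ), IsLazyWalkFrom μ ⌊m n * x⌋ S →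
        ∫⁻ ω, ENNReal.ofReal (Real.exp (C / m n *
          ∑' a : ℤ, (vertexOccupation (fun j => S j ω) ⌊m n ^ 2 * t⌋₊ a : ℝ) ^ q / m n ^ q)) ∂μ
          ≤ K := by
  obtain ⟨c, hc, hcm⟩ := hm.exists_pos_le
  set T : ℝ := t + (c ^ 2)⁻¹ with hT
  have hTpos : 0 < T := by positivity
  have hD : 0 < C * q * T := by positivity
  -- The rate `36 T`: with `α = 6 l / m n` and `u + 1 ≤ T (m n)²`, one gets `(u + 1) α² ≤ 36 T l²`.
  obtain ⟨K, hK⟩ := exists_lintegral_exp_rpow_le hD (sub_nonneg.2 hq1)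
    (by linarith : q - 1 < 2) (by positivity : 0 < 36 * T)
  refine ⟨K, fun n hn x _ Ω _ μ _ S hS => ?_⟩
  have hr : 0 < m n := hc.trans_le (hcm n hn)
  have hu := floor_sq_mul_add_one_le hc (hcm n hn) ht
  rw [← hT] at hu
  set u := ⌊m n ^ 2 * t⌋₊
  have hmeas : ∀ k, Measurable fun ω => S (k + 1) ω - S k ω := fun k =>
    (hS.measurable _).sub (hS.measurable _)
  have hYm : ∀ j, Measurable fun ω =>
      (zeroCount (fun k => S (j + k + 1) ω - S (j + k) ω) (u + 1) : ℝ) / m n := fun j =>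
    (measurable_zeroCount (fun k => hmeas (j + k)) (u + 1)).div_const _
  have hj : ∀ j, ∫⁻ ω, ENNReal.ofReal (Real.exp (C * q * T *
      ((zeroCount (fun k => S (j + k + 1) ω - S (j + k) ω) (u + 1) : ℝ) / m n) ^ (q - 1))) ∂μ
      ≤ K := by
    intro j
    refine hK Ω μ _ (hYm j) (fun ω => by positivity) fun l hl => ?_
    have h := lintegral_exp_zeroCount_le (ξ := fun k ω => S (j + k + 1) ω - S (j + k) ω)
      (fun k => hmeas (j + k)) (hS.indep.precomp (add_right_injective j))
      (fun k => hS.uniform (j + k)) (α := 6 * l / m n) (by positivity) (u + 1)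
    calc _ = _ := by
          refine lintegral_congr fun ω => ?_
          congr 2
          field_simp
      _ ≤ _ := h
      _ ≤ _ := by
          refine ENNReal.ofReal_le_ofReal
            (mul_le_mul_of_nonneg_left (Real.exp_le_exp.2 ?_) two_pos.le)
          calc ((u + 1 : ℕ) : ℝ) * (6 * l / m n) ^ 2 ≤ (T * m n ^ 2) * (6 * l / m n) ^ 2 := by
                gcongr
            _ = _ := by field_simp; ring
  calc _ ≤ ∫⁻ ω, ∑ j ∈ Finset.range (u + 1), ENNReal.ofReal ((u + 1 : ℕ) : ℝ)⁻¹ *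
        ENNReal.ofReal (Real.exp (C * q * T * ((zeroCount
          (fun k => S (j + k + 1) ω - S (j + k) ω) (u + 1) : ℝ) / m n) ^ (q - 1))) ∂μ := by
        refine lintegral_mono fun ω => ?_
        refine (ENNReal.ofReal_le_ofReal
          (exp_tsum_vertexOccupation_le hC hq1 hr (fun j => S j ω) u hu)).trans_eq ?_
        rw [ENNReal.ofReal_sum_of_nonneg fun _ _ => by positivity]
        exact Finset.sum_congr rfl fun j _ => ENNReal.ofReal_mul (by positivity)
    _ = ∑ j ∈ Finset.range (u + 1), ENNReal.ofReal ((u + 1 : ℕ) : ℝ)⁻¹ *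
        ∫⁻ ω, ENNReal.ofReal (Real.exp (C * q * T * ((zeroCount
          (fun k => S (j + k + 1) ω - S (j + k) ω) (u + 1) : ℝ) / m n) ^ (q - 1))) ∂μ := by
        rw [lintegral_finsetSum']
        · exact Finset.sum_congr rfl fun j _ => lintegral_const_mul' _ _ ENNReal.ofReal_ne_top
        · intro j _
          exact ((((hYm j).pow_const (q - 1)).const_mul (C * q * T)).exp.ennreal_ofReal.const_mul
            _).aemeasurable
    _ ≤ ∑ j ∈ Finset.range (u + 1), ENNReal.ofReal ((u + 1 : ℕ) : ℝ)⁻¹ * (K : ℝ≥0∞) :=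
        Finset.sum_le_sum fun j _ => mul_le_mul_right (hj j) _
    _ = K := by
        rw [Finset.sum_const, Finset.card_range, nsmul_eq_mul, ← mul_assoc,
          ENNReal.ofReal_inv_of_pos (by positivity), ENNReal.ofReal_natCast,
          ENNReal.mul_inv_cancel (by simp) (by simp), one_mul]
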